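/- Let $G$ be a (discrete) group that is amenable, i.e., every action of $G$ by homeomorphisms on a nonempty compact Hausdorff space $X$ admits a $G$-invariant Borel probability measure. Suppose that $G$ has a locally invariant order, i.e., a transitive, irreflexive binary relation $\prec$ on $G$ such that for all $x,y\in G$ with $y\neq e$, either $x\prec xy$ or $x\prec xy^{-1}$. Then $G$ is left-orderable, i.e., there is a strict total order $<$ on $G$ such that $x<y$ implies $gx<gy$ for all $x,y,g\in G$. Moreover, $G$ is locally indicable, i.e., every nontrivial finitely generated subgroup of $G$ has an infinite cyclic quotient. -/

import Mathlib

open MeasureTheory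

universe u

/-- A discrete group `G` is amenable if every action of `G` by homeomorphisms on a nonempty compact
Hausdorff space `X` has a `G`-invariant Borel probability measure. -/
def IsAmenableGroup (G : Type u) [Group G] : Prop :=
  ∀ (X : Type u) [TopologicalSpace X] [CompactSpace X] [T2Space X] [Nonempty X]
    [MeasurableSpace X] [BorelSpace X] [MulAction G X] [ContinuousConstSMul G X],
    ∃ μ : Measure X, IsProbabilityMeasure μ ∧ SMulInvariantMeasure G X μ

/-- A locally invariant order on `G`: a strict partial order `r` (read `r x y` as `x ≺ y`) such
that for all `x` and all `y ≠ 1`, either `x ≺ x * y` or `x ≺ x * y⁻¹`. -/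
structure IsLocallyInvariantOrder {G : Type u} [Group G] (r : G → G → Prop) : Prop where
  irrefl : ∀ x, ¬ r x x
  trans : ∀ x y z, r x y → r y z → r x z
  locallyInvariant : ∀ x y, y ≠ 1 → r x (x * y) ∨ r x (x * y⁻¹)

/-- A left-invariant strict total order on `G`. -/
structure IsLeftInvariantTotalOrder {G : Type u} [Group G] (r : G → G → Prop) : Prop where
  irrefl : ∀ x, ¬ r x x
  trans : ∀ x y z, r x y → r y z → r x z
  total : ∀ x y, x ≠ y → r x y ∨ r y x
  leftInvariant : ∀ g x y, r x y → r (g * x) (g * y)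

/-- `G` is left-orderable if it has a left-invariant total order. -/
def IsLeftOrderable (G : Type u) [Group G] : Prop :=
  ∃ r : G → G → Prop, IsLeftInvariantTotalOrder r

/-- `G` is locally indicable if every nontrivial finitely generated subgroup of `G` has an
infinite cyclic quotient. -/
def IsLocallyIndicable (G : Type u) [Group G] : Prop :=
  ∀ H : Subgroup G, H.FG → H ≠ ⊥ →
    ∃ (N : Subgroup H) (_ : N.Normal), IsCyclic (H ⧸ N) ∧ Infinite (H ⧸ N)

/-!
The proof applies Poincaré recurrence twice, to two compact spaces of binary relations on `G`.

*Left-orderability.* Left translation acts on the space of locally invariant orders. For a countable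
subgroup `H`, almost every order `≺` for an invariant measure is recurrent: each relation between
elements of `H` is preserved by left multiplication by a positive power of any given `g ∈ H`.
Local invariance says that along `n ↦ x * y ^ n` the order goes up forever once it goes up, and
recurrence then forces this sequence to be monotone. Hence `≺` is total on `H`, and the elements
above `1` form a semigroup (`IsLocallyInvariantOrder.one_mul_mem`), which is the positive cone of a
left order on `H`. An ultraproduct over the finitely generated subgroups gives a left order on `G`
(`isLeftOrderable_of_forall_fg`).

*Local indicability.* Right translation acts on the space of left orders. A left order recurrent for
this action on a finitely generated subgroup `H` is Conradian on `H`: if `1 < f` and `1 < g`,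
then `g ≤ g ^ n < f * g ^ n` for some `n`. By Conrad's theorem
(`IsConradian.exists_surjective_hom_int`) `H` maps onto `ℤ`: the largest convex subgroup of `H` that
misses a suitable `s > 1` is normal, the quotient is an Archimedean bi-ordered group, hence
commutative by Hölder's theorem, and it is finitely generated, torsion-free and nontrivial.
-/

/-! ### Powers in left-ordered groups -/

section LeftOrdered

variable {H : Type*} [Group H] [LinearOrder H] [MulLeftMono H]

theorem zpow_strictMono_of_one_lt {z : H} (hz : 1 < z) : StrictMono fun m : ℤ => z ^ m := by
  refine strictMono_int_of_lt_succ fun m => ?_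
  rw [zpow_add_one]
  exact lt_mul_of_one_lt_right' _ hz

theorem zpow_le_pow_natAbs {z : H} (hz : 1 ≤ z) (m : ℤ) : z ^ m ≤ z ^ m.natAbs := by
  rcases hz.eq_or_lt with rfl | hz
  · simp
  rw [← zpow_natCast]
  exact (zpow_strictMono_of_one_lt hz).monotone Int.le_natAbs

end LeftOrdered

/-! ### Archimedean bi-ordered groups -/

section Holder

variable {Q : Type*} [Group Q] [LinearOrder Q] [MulLeftMono Q] [MulRightMono Q]

/-- Every element lies between two consecutive powers of a given `z > 1`. -/
theorem exists_zpow_le_lt_of_archimedean (harch : ∀ p g : Q, 1 < p → ∃ n : ℕ, g ≤ p ^ n)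
    {z : Q} (hz : 1 < z) (a : Q) : ∃ m : ℤ, z ^ m ≤ a ∧ a < z ^ (m + 1) := by
  obtain ⟨n, hn⟩ := harch z a hz
  obtain ⟨k, hk⟩ := harch z a⁻¹ hz
  have hmono : StrictMono fun m : ℤ => z ^ m := zpow_strictMono_of_one_lt hz
  obtain ⟨m, hm, hmax⟩ := Int.exists_greatest_of_bdd (P := fun m => z ^ m ≤ a)
    ⟨n, fun m hm => hmono.le_iff_le.1 (by simpa using hm.trans hn)⟩
    ⟨-k, by simpa using inv_le_of_inv_le' hk⟩
  refine ⟨m, hm, lt_of_not_ge fun h => ?_⟩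
  have := hmax _ h
  omega

/-- Hölder's theorem: an Archimedean bi-ordered group is commutative. -/
theorem mul_comm_of_archimedean (harch : ∀ p g : Q, 1 < p → ∃ n : ℕ, g ≤ p ^ n) (a b : Q) :
    a * b = b * a := by
  by_cases hmin : ∃ z : Q, 1 < z ∧ ∀ w, 1 < w → z ≤ w
  · -- With a least positive element `z`, the group consists of the powers of `z`.
    obtain ⟨z, hz, hmin⟩ := hmin
    have key : ∀ a : Q, ∃ m : ℤ, a = z ^ m := by
      intro a
      obtain ⟨m, h1, h2⟩ := exists_zpow_le_lt_of_archimedean harch hz a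
      refine ⟨m, (h1.antisymm (not_lt.1 fun h => ?_)).symm⟩
      have h3 : z ≤ (z ^ m)⁻¹ * a := hmin _ (by rwa [lt_inv_mul_iff_mul_lt, mul_one])
      rw [le_inv_mul_iff_mul_le, ← zpow_add_one] at h3
      exact absurd h2 h3.not_gt
    obtain ⟨m, rfl⟩ := key a
    obtain ⟨n, rfl⟩ := key b
    rw [← zpow_add, ← zpow_add, add_comm]
  · push Not at hmin
    -- Otherwise squares of positive elements get arbitrarily small.
    have hsq : ∀ c : Q, 1 < c → ∃ z, 1 < z ∧ z * z ≤ c := by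
      intro c hc
      obtain ⟨w, hw, hwc⟩ := hmin c hc
      by_cases h : w * w ≤ c
      · exact ⟨w, hw, h⟩
      · have hv : 1 < w⁻¹ * c := by rwa [lt_inv_mul_iff_mul_lt, mul_one]
        have hvw : w⁻¹ * c < w := by rw [inv_mul_lt_iff_lt_mul]; exact not_le.1 h
        refine ⟨w⁻¹ * c, hv, ?_⟩
        calc w⁻¹ * c * (w⁻¹ * c) ≤ w * (w⁻¹ * c) := mul_le_mul_left hvw.le _
          _ = c := mul_inv_cancel_left _ _
    have key : ∀ a b : Q, ¬ b * a < a * b := by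
      intro a b hab
      obtain ⟨z, hz, hzc⟩ := hsq ((b * a)⁻¹ * (a * b)) (by rwa [lt_inv_mul_iff_mul_lt, mul_one])
      obtain ⟨m, hm1, hm2⟩ := exists_zpow_le_lt_of_archimedean harch hz a
      obtain ⟨n, hn1, hn2⟩ := exists_zpow_le_lt_of_archimedean harch hz b
      rw [le_inv_mul_iff_mul_le] at hzc
      have h1 : a * b < z ^ (m + 1) * z ^ (n + 1) := mul_lt_mul_of_lt_of_lt hm2 hn2
      have h2 : z ^ n * z ^ m * (z * z) ≤ b * a * (z * z) := mul_le_mul_left (mul_le_mul' hn1 hm1) _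
      refine (h1.trans_le (le_of_eq_of_le ?_ (h2.trans hzc))).false
      group
    exact le_antisymm (not_lt.1 (key a b)) (not_lt.1 (key b a))

end Holder

/-- A nontrivial finitely generated torsion-free commutative group maps onto `ℤ`. -/
theorem exists_surjective_hom_int {A : Type*} [CommGroup A] [Group.FG A] [Nontrivial A]
    [IsMulTorsionFree A] : ∃ φ : A →* Multiplicative ℤ, Function.Surjective φ := by
  have : Module.Finite ℤ (Additive A) := Module.Finite.iff_addGroup_fg.2 inferInstance
  let b := Module.Free.chooseBasis ℤ (Additive A)
  obtain ⟨i⟩ : Nonempty (Module.Free.ChooseBasisIndex ℤ (Additive A)) := b.index_nonempty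
  refine ⟨AddMonoidHom.toMultiplicativeRight (b.coord i).toAddMonoidHom, fun n => ?_⟩
  exact ⟨(n.toAdd • b i).toMul, by simp [AddMonoidHom.toMultiplicativeRight]⟩

/-- A nontrivial finitely generated group with an Archimedean bi-invariant total order maps onto
`ℤ`. The order is given by its cone `P` of positive elements. -/
theorem exists_surjective_hom_int_of_cone {Q : Type*} [Group Q] [Group.FG Q] [Nontrivial Q]
    (P : Q → Prop) (one : ¬ P 1) (mul : ∀ a b, P a → P b → P (a * b))
    (total : ∀ a, a ≠ 1 → P a ∨ P a⁻¹) (conj : ∀ a g, P a → P (g * a * g⁻¹))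
    (arch : ∀ p g, P p → ∃ n : ℕ, g = p ^ n ∨ P (g⁻¹ * p ^ n)) :
    ∃ φ : Q →* Multiplicative ℤ, Function.Surjective φ := by
  classical
  let _ : LinearOrder Q :=
    { le := fun a b => a = b ∨ P (a⁻¹ * b)
      le_refl := fun a => Or.inl rfl
      le_trans := by
        rintro a b c (rfl | h1) (rfl | h2)
        · exact Or.inl rfl
        · exact Or.inr h2
        · exact Or.inr h1
        · exact Or.inr (by simpa [mul_assoc] using mul _ _ h1 h2)
      le_antisymm := by
        rintro a b (rfl | h1) (h2 | h2)
        · rfl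
        · rfl
        · exact h2.symm
        · exact absurd (by simpa [mul_assoc] using mul _ _ h1 h2) one
      le_total := by
        intro a b
        by_cases h : a = b
        · exact Or.inl (Or.inl h)
        · rcases total (a⁻¹ * b) (fun h' => h (inv_mul_eq_one.1 h')) with h | h
          · exact Or.inl (Or.inr h)
          · exact Or.inr (Or.inr (by simpa using h))
      toDecidableLE := Classical.decRel _ }
  have : MulLeftMono Q := ⟨fun g a b h => by
    rcases h with rfl | h
    · exact le_rfl
    · exact Or.inr (by simpa [mul_assoc] using h)⟩
  have : MulRightMono Q := ⟨fun g a b h => by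
    rcases h with rfl | h
    · exact le_rfl
    · exact Or.inr (by simpa [mul_assoc, Function.swap] using conj _ g⁻¹ h)⟩
  have hcomm := mul_comm_of_archimedean (Q := Q) fun p g hp => by
    rcases hp.le with h | h
    · exact absurd h hp.ne
    · exact arch p g (by simpa using h)
  let _ : CommGroup Q := { ‹Group Q› with mul_comm := hcomm }
  have : IsOrderedMonoid Q := { mul_le_mul_left := fun a b h c => mul_le_mul_left h c }
  exact exists_surjective_hom_int

/-! ### Conradian left-ordered groups -/

section Conrad

variable {H : Type*} [Group H] [LinearOrder H] [MulLeftMono H]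

/-- A left order on `H` is Conradian if `f * g ^ n` eventually exceeds `g`, for all positive
`f` and `g`. -/
def IsConradian (H : Type*) [Group H] [LinearOrder H] : Prop :=
  ∀ f g : H, 1 < f → 1 < g → ∃ n : ℕ, g < f * g ^ n

/-- In a Conradian order the exponent `n = 2` always works. -/
theorem IsConradian.lt_mul_sq (hC : IsConradian H) {f g : H} (hf : 1 < f) (hg : 1 < g) :
    g < f * (g * g) := by
  by_contra hcon
  rw [not_lt] at hcon
  -- Otherwise `f` and `h = f * g` violate the Conradian property, as `h ^ n < g` for all `n`.
  have hle : ∀ n : ℕ, (f * g) ^ n * g ≤ g := by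
    intro n
    induction n with
    | zero => simp
    | succ n ih =>
      calc (f * g) ^ (n + 1) * g = (f * g) ^ n * (f * (g * g)) := by rw [pow_succ]; group
        _ ≤ (f * g) ^ n * g := mul_le_mul_right hcon _
        _ ≤ g := ih
  obtain ⟨n, hn⟩ := hC f (f * g) hf (one_lt_mul' hf hg)
  refine (hn.trans (mul_lt_mul_right ?_ f)).false
  exact (lt_mul_of_one_lt_right' _ hg).trans_le (hle n)

/-- In a Conradian order, being bounded above by a power of `g` is stable under multiplication on
the right by powers of `g`. -/
theorem IsConradian.exists_mul_pow_le (hC : IsConradian H) {g h : H} (hg : 1 ≤ g) {n : ℕ}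
    (hh : h ≤ g ^ n) (m : ℕ) : ∃ N : ℕ, h * g ^ m ≤ g ^ N := by
  rcases hg.eq_or_lt with rfl | hg
  · exact ⟨0, by simpa using hh⟩
  rcases Nat.eq_zero_or_pos m with rfl | hm
  · exact ⟨n, by simpa using hh⟩
  rcases hh.eq_or_lt with rfl | hh
  · exact ⟨n + m, (pow_add g n m).ge⟩
  have hgm : 1 < g ^ m := one_lt_pow' hg hm.ne'
  have hf : 1 < h⁻¹ * g ^ n := by rwa [lt_inv_mul_iff_mul_lt, mul_one]
  obtain ⟨k, hk⟩ := hC _ _ hf hgm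
  refine ⟨n + m * k, ?_⟩
  rw [mul_assoc, lt_inv_mul_iff_mul_lt, ← pow_mul, ← pow_add] at hk
  exact hk.le

/-- The submonoid of elements bounded above by some power of `g`, in a Conradian order. -/
def IsConradian.powBounded (hC : IsConradian H) (g : H) (hg : 1 ≤ g) : Submonoid H where
  carrier := {h | ∃ n : ℕ, h ≤ g ^ n}
  one_mem' := ⟨0, by simp⟩
  mul_mem' := by
    rintro a b ⟨n, hn⟩ ⟨m, hm⟩
    obtain ⟨N, hN⟩ := hC.exists_mul_pow_le hg hn m
    exact ⟨N, (mul_le_mul_right hm a).trans hN⟩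

theorem IsConradian.mem_powBounded (hC : IsConradian H) {g : H} (hg : 1 ≤ g) {h : H} :
    h ∈ hC.powBounded g hg ↔ ∃ n : ℕ, h ≤ g ^ n := Iff.rfl

theorem IsConradian.powBounded_mono (hC : IsConradian H) {g k : H} (hg : 1 ≤ g) (hk : 1 ≤ k)
    (h : g ∈ hC.powBounded k hk) : hC.powBounded g hg ≤ hC.powBounded k hk := by
  rintro x ⟨n, hn⟩
  obtain ⟨m, hm⟩ := pow_mem h n
  exact ⟨m, hn.trans hm⟩

theorem IsConradian.zpow_mem_powBounded (hC : IsConradian H) {g h : H} (hg : 1 ≤ g)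
    (h1 : h ∈ hC.powBounded g hg) (h2 : h⁻¹ ∈ hC.powBounded g hg) (n : ℤ) :
    h ^ n ∈ hC.powBounded g hg := by
  obtain ⟨k, rfl | rfl⟩ := n.eq_nat_or_neg
  · simpa using pow_mem h1 k
  · simpa using pow_mem h2 k

/-- The elements all of whose powers lie below `s`, which form a subgroup in a Conradian order: the
largest convex subgroup that does not contain `s`. -/
def IsConradian.belowSubgroup (hC : IsConradian H) (s : H) (hs : 1 < s) : Subgroup H where
  carrier := {h | ∀ n : ℤ, h ^ n < s}
  one_mem' := by simpa using hs
  inv_mem' := by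
    intro h hh n
    simpa using hh (-n)
  mul_mem' := by
    intro a b ha hb
    -- `t` is the largest of `a`, `b` and their inverses
    obtain ⟨t, ht1, ht, h1, h2, h3, h4⟩ : ∃ t : H, 1 ≤ t ∧ (∀ n : ℤ, t ^ n < s) ∧
        a ≤ t ∧ a⁻¹ ≤ t ∧ b ≤ t ∧ b⁻¹ ≤ t := by
      have key : ∀ x : H, (∀ n : ℤ, x ^ n < s) → ∃ t : H, 1 ≤ t ∧ (∀ n : ℤ, t ^ n < s) ∧
          x ≤ t ∧ x⁻¹ ≤ t := by
        intro x hx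
        rcases le_total 1 x with h | h
        · exact ⟨x, h, hx, le_rfl, (Left.inv_le_one_iff.2 h).trans h⟩
        · have h' := Left.one_le_inv_iff.2 h
          exact ⟨x⁻¹, h', fun n => by simpa using hx (-n), h.trans h', le_rfl⟩
      obtain ⟨t, h1, h2, h3, h4⟩ := key a ha
      obtain ⟨u, k1, k2, k3, k4⟩ := key b hb
      rcases le_total t u with h | h
      · exact ⟨u, k1, k2, h3.trans h, h4.trans h, k3, k4⟩
      · exact ⟨t, h1, h2, h3, h4, k3.trans h, k4.trans h⟩
    have mem : ∀ x : H, x ≤ t → x ∈ hC.powBounded t ht1 := fun x hx => ⟨1, by simpa using hx⟩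
    intro n
    obtain ⟨N, hN⟩ := hC.zpow_mem_powBounded ht1 (mul_mem (mem _ h1) (mem _ h3))
      (by rw [mul_inv_rev]; exact mul_mem (mem _ h4) (mem _ h2)) n
    exact hN.trans_lt (by simpa using ht N)

theorem IsConradian.mem_belowSubgroup (hC : IsConradian H) {s : H} (hs : 1 < s) {h : H} :
    h ∈ hC.belowSubgroup s hs ↔ ∀ n : ℤ, h ^ n < s := Iff.rfl

/-- If the powers of `s` are cofinal and `s` is bounded by a power of `p`, then the powers of `p` are
cofinal. -/
theorem IsConradian.exists_le_pow_of_le (hC : IsConradian H) {s : H} (hs : 1 < s)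
    (hcof : ∀ h : H, ∃ n : ℕ, h ≤ s ^ n)
    {p : H} (hp : 1 ≤ p) (hsp : s ∈ hC.powBounded p hp)
    (g : H) : ∃ n : ℕ, g ≤ p ^ n :=
  hC.powBounded_mono hs.le hp hsp (hcof g)

/-- The powers of a positive element outside the convex subgroup are cofinal. -/
theorem IsConradian.exists_le_pow_of_notMem (hC : IsConradian H) {s : H} (hs : 1 < s)
    (hcof : ∀ h : H, ∃ n : ℕ, h ≤ s ^ n)
    {p : H} (hp : 1 < p)
    (hpC : p ∉ hC.belowSubgroup s hs) (g : H) : ∃ n : ℕ, g ≤ p ^ n := by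
  rw [hC.mem_belowSubgroup] at hpC
  push Not at hpC
  obtain ⟨n, hn⟩ := hpC
  exact hC.exists_le_pow_of_le hs hcof hp.le ⟨_, hn.trans (zpow_le_pow_natAbs hp.le n)⟩ g

theorem IsConradian.lt_of_mem_of_notMem (hC : IsConradian H) {s : H} (hs : 1 < s)
    (hcof : ∀ h : H, ∃ n : ℕ, h ≤ s ^ n)
    {p c : H} (hp : 1 < p)
    (hpC : p ∉ hC.belowSubgroup s hs) (hc : c ∈ hC.belowSubgroup s hs) : c < p := by
  by_contra h
  rw [not_lt] at h
  have hc1 : 1 ≤ c := hp.le.trans h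
  obtain ⟨n, hn⟩ := hC.exists_le_pow_of_notMem hs hcof hp hpC s
  obtain ⟨m, hm⟩ := pow_mem (show p ∈ hC.powBounded c hc1 from ⟨1, by simpa using h⟩) n
  have := (hC.mem_belowSubgroup hs).1 hc m
  rw [zpow_natCast] at this
  exact ((hn.trans hm).trans_lt this).false

theorem IsConradian.belowSubgroup_normal (hC : IsConradian H) {s : H} (hs : 1 < s)
    (hcof : ∀ h : H, ∃ n : ℕ, h ≤ s ^ n) : (hC.belowSubgroup s hs).Normal := by
  refine ⟨fun h hh g => ?_⟩
  by_contra hcon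
  have hg : g ∉ hC.belowSubgroup s hs := fun hg =>
    hcon (mul_mem (mul_mem hg hh) (inv_mem hg))
  rw [hC.mem_belowSubgroup] at hcon
  push Not at hcon
  obtain ⟨n, hn⟩ := hcon
  rw [conj_zpow] at hn
  -- Powers of `x = g * c * g⁻¹` are cofinal, where `c ∈ C`.
  set c := h ^ n with hc
  have hcC : c ∈ hC.belowSubgroup s hs := zpow_mem hh n
  have hx := hC.exists_le_pow_of_le hs hcof (hs.le.trans hn) ⟨1, by simpa using hn⟩
  simp only [conj_pow] at hx
  rcases le_or_gt 1 g with h1 | h1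
  · -- If `g ≥ 1` then `s ≤ c ^ m * g⁻¹ ≤ c ^ m < s`.
    obtain ⟨m, hm⟩ := hx (g * s)
    rw [mul_assoc] at hm
    have h2 : s ≤ c ^ m * g⁻¹ := le_of_mul_le_mul_left' hm
    have h3 : c ^ m * g⁻¹ ≤ c ^ m := mul_le_of_le_one_right' (Left.inv_le_one_iff.2 h1)
    have h4 := (hC.mem_belowSubgroup hs).1 hcC m
    rw [zpow_natCast] at h4
    exact ((h2.trans h3).trans_lt h4).false
  · -- If `p = g⁻¹ > 1` then `p ^ 3 ≤ c ^ m * p`, so that `c⁻ᵐ * p` and `p` violate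
    -- `IsConradian.lt_mul_sq`.
    obtain ⟨p, rfl⟩ : ∃ p, g = p⁻¹ := ⟨g⁻¹, (inv_inv g).symm⟩
    rw [Left.inv_lt_one_iff] at h1
    rw [inv_mem_iff] at hg
    obtain ⟨m, hm⟩ := hx (p * p)
    rw [inv_inv, mul_assoc, le_inv_mul_iff_mul_le] at hm
    have hlt : c ^ m < p := hC.lt_of_mem_of_notMem hs hcof h1 hg (pow_mem hcC m)
    have hq : 1 < (c ^ m)⁻¹ * p := by rwa [lt_inv_mul_iff_mul_lt, mul_one]
    have h2 := hC.lt_mul_sq hq h1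
    rw [mul_assoc, lt_inv_mul_iff_mul_lt] at h2
    exact (h2.trans_le hm).false

/-- Positivity outside the convex subgroup `C` is invariant under conjugation. -/
theorem IsConradian.one_lt_conj (hC : IsConradian H) {s : H} (hs : 1 < s)
    (hcof : ∀ h : H, ∃ n : ℕ, h ≤ s ^ n)
    {p : H} (hp : 1 < p) (hpC : p ∉ hC.belowSubgroup s hs) (g : H) :
    1 < g * p * g⁻¹ := by
  have hN := hC.belowSubgroup_normal hs hcof
  have key : ∀ k p : H, 1 ≤ k → 1 < p → p ∉ hC.belowSubgroup s hs → 1 < k⁻¹ * p * k := by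
    intro k p hk hp hpC
    by_contra hcon
    rw [not_lt] at hcon
    obtain ⟨n, hn⟩ := hC.exists_le_pow_of_notMem hs hcof hp hpC (k * p)
    have h1 : (k⁻¹ * p * k) ^ n ≤ 1 := pow_le_one' hcon n
    have h2 : (k⁻¹ * p * k) ^ n = k⁻¹ * p ^ n * k := by
      simpa using (conj_pow (i := n) (a := k⁻¹) (b := p))
    rw [h2, mul_assoc, inv_mul_le_iff_le_mul, mul_one] at h1
    have h3 : p ^ n ≤ p ^ n * k := le_mul_of_one_le_right' hk
    exact (((lt_mul_of_one_lt_right' k hp).trans_le hn).trans_le (h3.trans h1)).false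
  rcases le_total 1 g with hg | hg
  · by_contra hcon
    rw [not_lt] at hcon
    have hx : g * p⁻¹ * g⁻¹ = (g * p * g⁻¹)⁻¹ := by group
    have hxC : g * p⁻¹ * g⁻¹ ∉ hC.belowSubgroup s hs := fun h => hpC <| by
      rw [← inv_mem_iff]
      simpa [mul_assoc] using hN.conj_mem _ h g⁻¹
    have hx1 : 1 < g * p⁻¹ * g⁻¹ := by
      refine lt_of_le_of_ne ?_ fun h => hxC (h ▸ one_mem _)
      rw [hx]
      exact Left.one_le_inv_iff.2 hcon
    have := key g _ hg hx1 hxC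
    simp only [mul_assoc, inv_mul_cancel_left, inv_mul_cancel, mul_one] at this
    exact (hp.trans (Left.one_lt_inv_iff.1 this)).false
  · simpa using key g⁻¹ p (Left.one_le_inv_iff.2 hg) hp hpC

/-- The cone of the quotient by the largest convex subgroup not containing `s`: the classes of the
positive elements outside that subgroup. -/
def IsConradian.quotientCone (hC : IsConradian H) {s : H} (hs : 1 < s)
    (q : H ⧸ hC.belowSubgroup s hs) : Prop :=
  ∃ h : H, (h : H ⧸ hC.belowSubgroup s hs) = q ∧ 1 < h ∧ h ∉ hC.belowSubgroup s hs

/-- Conrad's theorem: a nontrivial finitely generated group with a Conradian left order maps onto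
`ℤ`. -/
theorem IsConradian.exists_surjective_hom_int [Group.FG H] [Nontrivial H] (hC : IsConradian H) :
    ∃ φ : H →* Multiplicative ℤ, Function.Surjective φ := by
  -- Choose `s > 1` above every generator and its inverse; then the powers of `s` are cofinal.
  obtain ⟨s, hs, hcof⟩ : ∃ s : H, 1 < s ∧ ∀ h : H, ∃ n : ℕ, h ≤ s ^ n := by
    obtain ⟨S, hS⟩ := Group.FG.out (G := H)
    obtain ⟨a, ha⟩ := exists_ne (1 : H)
    obtain ⟨s, hs⟩ := (((S.finite_toSet.union (S.finite_toSet.inv)).insert a).insert a⁻¹).bddAbove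
    have hs1 : 1 < s := by
      rcases ha.lt_or_gt with h | h
      · exact (Left.one_lt_inv_iff.2 h).trans_le (hs (by simp))
      · exact h.trans_le (hs (by simp))
    refine ⟨s, hs1, fun h => ?_⟩
    have key : ∀ x ∈ Subgroup.closure (S : Set H),
        x ∈ hC.powBounded s hs1.le ∧ x⁻¹ ∈ hC.powBounded s hs1.le := by
      intro x hx
      induction hx using Subgroup.closure_induction with
      | mem x hx =>
        have hx' : x ∈ S := hx
        exact ⟨⟨1, by simpa using hs (by simp [hx'])⟩, ⟨1, by simpa using hs (by simp [hx'])⟩⟩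
      | one => exact ⟨one_mem _, by simp⟩
      | mul x y _ _ hx hy => exact ⟨mul_mem hx.1 hy.1, by rw [mul_inv_rev]; exact mul_mem hy.2 hx.2⟩
      | inv x _ hx => exact ⟨hx.2, by rw [inv_inv]; exact hx.1⟩
    exact (key h (hS ▸ Subgroup.mem_top h)).1
  have hN := hC.belowSubgroup_normal hs hcof
  have hsC : s ∉ hC.belowSubgroup s hs := fun h => by
    simpa using (hC.mem_belowSubgroup hs).1 h 1
  have : Nontrivial (H ⧸ hC.belowSubgroup s hs) :=
    ⟨(s : H ⧸ hC.belowSubgroup s hs), 1, fun h => hsC ((QuotientGroup.eq_one_iff s).1 h)⟩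
  suffices ∃ φ : H ⧸ hC.belowSubgroup s hs →* Multiplicative ℤ, Function.Surjective φ by
    obtain ⟨φ, hφ⟩ := this
    exact ⟨φ.comp (QuotientGroup.mk' _), hφ.comp (QuotientGroup.mk'_surjective _)⟩
  refine exists_surjective_hom_int_of_cone (hC.quotientCone hs) ?_ ?_ ?_ ?_ ?_
  · rintro ⟨h, h1, -, h2⟩
    exact h2 ((QuotientGroup.eq_one_iff h).1 h1)
  · rintro _ _ ⟨h, rfl, h1, h2⟩ ⟨k, rfl, k1, -⟩
    refine ⟨h * k, rfl, one_lt_mul' h1 k1, fun hk => ?_⟩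
    exact ((lt_mul_of_one_lt_right' h k1).trans (hC.lt_of_mem_of_notMem hs hcof h1 h2 hk)).false
  · intro q hq
    obtain ⟨h, rfl⟩ := QuotientGroup.mk_surjective q
    have hh : h ∉ hC.belowSubgroup s hs := fun hh => hq ((QuotientGroup.eq_one_iff h).2 hh)
    rcases lt_trichotomy h 1 with h1 | rfl | h1
    · exact Or.inr ⟨h⁻¹, rfl, Left.one_lt_inv_iff.2 h1, fun h2 => hh (inv_mem_iff.1 h2)⟩
    · exact absurd (one_mem _) hh
    · exact Or.inl ⟨h, rfl, h1, hh⟩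
  · rintro _ g ⟨h, rfl, h1, h2⟩
    obtain ⟨k, rfl⟩ := QuotientGroup.mk_surjective g
    refine ⟨k * h * k⁻¹, rfl, hC.one_lt_conj hs hcof h1 h2 k, fun h3 => h2 ?_⟩
    simpa [mul_assoc] using hN.conj_mem _ h3 k⁻¹
  · rintro _ g ⟨h, rfl, h1, h2⟩
    obtain ⟨k, rfl⟩ := QuotientGroup.mk_surjective g
    obtain ⟨n, hn⟩ := hC.exists_le_pow_of_notMem hs hcof h1 h2 k
    by_cases hk : k⁻¹ * h ^ n ∈ hC.belowSubgroup s hs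
    · exact ⟨n, Or.inl (QuotientGroup.eq.2 hk)⟩
    · refine ⟨n, Or.inr ⟨k⁻¹ * h ^ n, rfl, lt_of_le_of_ne ?_ fun h => hk (h ▸ one_mem _), hk⟩⟩
      rwa [le_inv_mul_iff_mul_le, mul_one]

end Conrad

/-! ### Recurrence -/

/-- Poincaré recurrence for an amenable group acting on a compact Hausdorff space: for countably
many pairs of an open set `U i` and a group element `g i`, some point `x` returns to each `U i`
containing it under a positive power of `g i`. -/
theorem IsAmenableGroup.exists_recurrent {G : Type u} [Group G] (hG : IsAmenableGroup G)
    {X : Type u} [TopologicalSpace X] [CompactSpace X] [T2Space X] [Nonempty X]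
    [MulAction G X] [ContinuousConstSMul G X] {ι : Type*} [Countable ι] (U : ι → Set X)
    (hU : ∀ i, IsOpen (U i)) (g : ι → G) :
    ∃ x : X, ∀ i, x ∈ U i → ∃ n : ℕ, 0 < n ∧ g i ^ n • x ∈ U i := by
  let _ : MeasurableSpace X := borel X
  have : BorelSpace X := ⟨rfl⟩
  obtain ⟨μ, hμ, hinv⟩ := hG X
  have hae : ∀ᵐ x ∂μ, ∀ i, x ∈ U i → ∃ n : ℕ, 0 < n ∧ g i ^ n • x ∈ U i := by
    rw [ae_all_iff]
    intro i
    have hcons := (measurePreserving_smul (g i) μ).conservative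
    filter_upwards [hcons.ae_mem_imp_frequently_image_mem (hU i).measurableSet.nullMeasurableSet]
      with x hx hxU
    obtain ⟨n, hn, hn'⟩ := ((hx hxU).and_eventually (Filter.eventually_gt_atTop 0)).exists
    refine ⟨n, hn', ?_⟩
    rwa [smul_iterate] at hn
  exact hae.exists

/-- Recurrence for `Bool`-valued relations on `G`, under the action induced by an action `a` of
the amenable group `G` on itself: a nonempty closed invariant set of relations contains one in
which every relation `r x y` between elements of a countable subgroup `H` recurs along each cyclic
subgroup of `H`. -/
theorem IsAmenableGroup.exists_recurrent_relation {G : Type u} [Group G] (hG : IsAmenableGroup G)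
    (a : G →* Equiv.Perm G) {K : Set (G → G → Bool)} (hK : IsClosed K) (hne : K.Nonempty)
    (hinv : ∀ r ∈ K, ∀ g, (fun x y => r (a g x) (a g y)) ∈ K) (H : Subgroup G) [Countable H] :
    ∃ r ∈ K, ∀ g ∈ H, ∀ x ∈ H, ∀ y ∈ H, r x y = true →
      ∃ n : ℕ, 0 < n ∧ r (a (g ^ n) x) (a (g ^ n) y) = true := by
  have : CompactSpace K := isCompact_iff_compactSpace.1 hK.isCompact
  have : Nonempty K := hne.to_subtype
  let _ : MulAction G K :=
    { smul := fun g r => ⟨fun x y => r.1 (a g⁻¹ x) (a g⁻¹ y), hinv _ r.2 _⟩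
      one_smul := fun r => Subtype.ext <| by
        change (fun x y => r.1 (a 1⁻¹ x) (a 1⁻¹ y)) = _
        simp
      mul_smul := fun g h r => Subtype.ext <| by
        change (fun x y => r.1 (a (g * h)⁻¹ x) (a (g * h)⁻¹ y)) =
          fun x y => r.1 (a h⁻¹ (a g⁻¹ x)) (a h⁻¹ (a g⁻¹ y))
        simp [mul_inv_rev, -map_inv] }
  have smul_apply : ∀ (g : G) (r : K) (x y : G), (g • r).1 x y = r.1 (a g⁻¹ x) (a g⁻¹ y) :=
    fun _ _ _ _ => rfl
  have hcont : ∀ x y : G, Continuous fun r : K => r.1 x y := fun x y =>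
    (continuous_apply y).comp ((continuous_apply x).comp continuous_subtype_val)
  have : ContinuousConstSMul G K := ⟨fun g => Continuous.subtype_mk
    (continuous_pi fun x => continuous_pi fun y => hcont (a g⁻¹ x) (a g⁻¹ y)) _⟩
  obtain ⟨r, hr⟩ := hG.exists_recurrent (X := K) (ι := H × H × H)
    (fun i => {r | r.1 i.2.1 i.2.2 = true})
    (fun i => (isOpen_discrete {true}).preimage (hcont i.2.1 i.2.2)) (fun i => (i.1 : G)⁻¹)
  refine ⟨r.1, r.2, fun g hg x hx y hy hxy => ?_⟩
  obtain ⟨n, hn, hn'⟩ := hr ⟨⟨g, hg⟩, ⟨x, hx⟩, ⟨y, hy⟩⟩ hxy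
  refine ⟨n, hn, ?_⟩
  rw [Set.mem_ofPred_eq, smul_apply] at hn'
  simpa using hn'

/-- The right translation action of a group on itself, by `g • x = x * g⁻¹`. -/
def rightTranslation (G : Type*) [Group G] : G →* Equiv.Perm G where
  toFun g := Equiv.mulRight g⁻¹
  map_one' := by ext; simp
  map_mul' g h := by ext; simp [mul_assoc]

theorem countable_of_group_fg (H : Type*) [Group H] [Group.FG H] : Countable H := by
  obtain ⟨S, _, φ, hφ⟩ := Group.fg_iff_exists_freeGroup_hom_surjective_finite.1 ‹Group.FG H›
  exact hφ.countable

/-! ### Recurrent locally invariant orders -/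

/-- A relation `r` on `G` is recurrent along the cyclic subgroups of `H`: each relation `r x y`
between elements of `H` is preserved by left multiplication by some positive power of each
`g ∈ H`. -/
def IsLeftRecurrent {G : Type*} [Group G] (r : G → G → Prop) (H : Subgroup G) : Prop :=
  ∀ g ∈ H, ∀ x ∈ H, ∀ y ∈ H, r x y → ∃ n : ℕ, 0 < n ∧ r (g ^ n * x) (g ^ n * y)

section LocallyInvariant

variable {G : Type u} [Group G] {r : G → G → Prop}

theorem IsLocallyInvariantOrder.asymm (hr : IsLocallyInvariantOrder r) {x y : G} (h : r x y) :
    ¬ r y x := fun h' => hr.irrefl _ (hr.trans _ _ _ h h')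

/-- Once a locally invariant order increases along `x * y ^ n`, it keeps increasing. -/
theorem IsLocallyInvariantOrder.mul_pow (hr : IsLocallyInvariantOrder r) {x y : G}
    (h : r x (x * y)) (k : ℕ) : r (x * y ^ k) (x * y ^ (k + 1)) := by
  have hy : y ≠ 1 := by
    rintro rfl
    exact hr.irrefl x (by simpa using h)
  induction k with
  | zero => simpa using h
  | succ k ih =>
    rcases hr.locallyInvariant (x * y ^ (k + 1)) y hy with h' | h'
    · rwa [mul_assoc, ← pow_succ] at h'
    · rw [mul_assoc, pow_succ y k, mul_inv_cancel_right, ← pow_succ] at h'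
      exact absurd h' (hr.asymm ih)

variable {H : Subgroup G}

/-- Recurrence along `x * y * x⁻¹` moves a relation along the coset `x * y ^ n`. -/
theorem IsLeftRecurrent.exists_mul_pow (hH : IsLeftRecurrent r H) {x y z : G} (hx : x ∈ H)
    (hy : y ∈ H) (hz : z ∈ H) (h : r x (x * z)) :
    ∃ n : ℕ, 0 < n ∧ r (x * y ^ n) (x * y ^ n * z) := by
  obtain ⟨n, hn, h'⟩ := hH (x * y * x⁻¹) (mul_mem (mul_mem hx hy) (inv_mem hx)) x hx _
    (mul_mem hx hz) h
  rw [conj_pow, ← mul_assoc, inv_mul_cancel_right] at h'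
  exact ⟨n, hn, by simpa [mul_assoc] using h'⟩

/-- By recurrence, a locally invariant order cannot increase in both directions along
`n ↦ x * y ^ n`. -/
theorem IsLocallyInvariantOrder.not_mul_and_mul_inv (hr : IsLocallyInvariantOrder r)
    (hH : IsLeftRecurrent r H) {x y : G} (hx : x ∈ H) (hy : y ∈ H) (h : r x (x * y)) :
    ¬ r x (x * y⁻¹) := by
  intro h'
  obtain ⟨n, hn, h2⟩ := hH.exists_mul_pow hx hy (inv_mem hy) h'
  obtain ⟨k, rfl⟩ := Nat.exists_eq_add_of_lt hn
  rw [zero_add, mul_assoc, pow_succ, mul_inv_cancel_right, ← pow_succ] at h2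
  exact hr.asymm h2 (hr.mul_pow h k)

/-- A recurrent locally invariant order is total. -/
theorem IsLocallyInvariantOrder.total (hr : IsLocallyInvariantOrder r)
    (hH : IsLeftRecurrent r H) {x z : G} (hx : x ∈ H) (hz : z ∈ H) (hxz : x ≠ z) :
    r x z ∨ r z x := by
  obtain ⟨y, rfl⟩ : ∃ y, z = x * y := ⟨x⁻¹ * z, by simp⟩
  have hy : y ∈ H := (Subgroup.mul_mem_cancel_left H hx).1 hz
  have hy1 : y ≠ 1 := fun h => hxz (by simp [h])
  rcases hr.locallyInvariant x y hy1 with h | h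
  · exact Or.inl h
  rcases hr.locallyInvariant (x * y) y hy1 with h2 | h2
  · -- The relation `x * y ^ n ≺ x * y ^ (n - 1)` recurs, which is only possible for `n = 1`.
    obtain ⟨n, hn, h3⟩ := hH.exists_mul_pow hx hy (inv_mem hy) h
    obtain ⟨k, rfl⟩ := Nat.exists_eq_add_of_lt hn
    rcases k with _ | k
    · exact Or.inr (by simpa using h3)
    · have h4 := hr.mul_pow h2 k
      rw [mul_assoc, mul_assoc, ← pow_succ', ← pow_succ'] at h4
      rw [zero_add, mul_assoc, pow_succ _ (k + 1), mul_inv_cancel_right, ← pow_succ] at h3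
      exact absurd h4 (hr.asymm h3)
  · exact Or.inr (by simpa using h2)

/-- Once a recurrent locally invariant order decreases along `x * y ^ n`, it keeps decreasing. -/
theorem IsLocallyInvariantOrder.mul_pow_of_gt (hr : IsLocallyInvariantOrder r)
    (hH : IsLeftRecurrent r H) {x y : G} (hx : x ∈ H) (hy : y ∈ H) (h : r (x * y) x) (k : ℕ) :
    r (x * y ^ (k + 1)) (x * y ^ k) := by
  have hy1 : y ≠ 1 := by
    rintro rfl
    exact hr.irrefl x (by simpa using h)
  induction k with
  | zero => simpa using h
  | succ k ih =>
    have hmem : x * y ^ (k + 1) ∈ H := mul_mem hx (pow_mem hy _)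
    have key : x * y ^ (k + 1 + 1) = x * y ^ (k + 1) * y := by rw [pow_succ _ (k + 1), mul_assoc]
    rw [key]
    rcases hr.total hH hmem (mul_mem hmem hy) (by simpa using hy1) with h' | h'
    · refine absurd ?_ (hr.not_mul_and_mul_inv hH hmem hy h')
      rwa [mul_assoc, pow_succ _ k, mul_inv_cancel_right, ← pow_succ]
    · exact h'

/-- The elements above `1` for a recurrent locally invariant order form a semigroup. The reason is
that `x ^ n * y = y * (y⁻¹ * x * y) ^ n` is monotone in `n`: if `x * y ≺ 1 ≺ y`, it is decreasing,
so that `x ^ n * y ≺ 1 ≺ x ^ n` for all `n ≥ 1`, whereas the relation `1 ≺ y` recurs along the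
powers of `x`. -/
theorem IsLocallyInvariantOrder.one_mul_mem (hr : IsLocallyInvariantOrder r)
    (hH : IsLeftRecurrent r H) {x y : G} (hx : x ∈ H) (hy : y ∈ H) (h1x : r 1 x) (h1y : r 1 y) :
    r 1 (x * y) := by
  by_cases hxy : x * y = 1
  · obtain rfl := eq_inv_of_mul_eq_one_right hxy
    exact absurd (by simpa using h1y)
      (hr.not_mul_and_mul_inv hH (one_mem H) hx (by simpa using h1x))
  rcases hr.total hH (one_mem H) (mul_mem hx hy) (Ne.symm hxy) with h | h
  · exact h
  exfalso
  have hc : y⁻¹ * x * y ∈ H := mul_mem (mul_mem (inv_mem hy) hx) hy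
  have key : ∀ n : ℕ, y * (y⁻¹ * x * y) ^ n = x ^ n * y := by
    intro n
    have := conj_pow (i := n) (a := y⁻¹) (b := x)
    rw [inv_inv] at this
    rw [this, mul_assoc, mul_inv_cancel_left]
  have hdec : ∀ n : ℕ, r (x ^ (n + 1) * y) 1 := by
    intro n
    induction n with
    | zero => simpa using h
    | succ n ih =>
      have := hr.mul_pow_of_gt hH hy hc (by simpa [mul_assoc] using hr.trans _ _ _ h h1y) (n + 1)
      rw [key, key] at this
      exact hr.trans _ _ _ this ih
  have hinc : ∀ n : ℕ, r 1 (x ^ (n + 1)) := by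
    intro n
    induction n with
    | zero => simpa using h1x
    | succ n ih =>
      exact hr.trans _ _ _ ih (by simpa using hr.mul_pow (x := 1) (by simpa using h1x) (n + 1))
  obtain ⟨n, hn, h2⟩ := hH x hx 1 (one_mem H) y hy h1y
  obtain ⟨k, rfl⟩ := Nat.exists_eq_add_of_lt hn
  rw [zero_add, mul_one] at h2
  exact hr.irrefl 1 (hr.trans _ _ _ (hinc k) (hr.trans _ _ _ h2 (hdec k)))

/-- The elements of `H` above `1` for a recurrent locally invariant order are the positive cone of a
left order. This left order need not agree with the given order away from `1`. -/
theorem IsLocallyInvariantOrder.isLeftOrderable (hr : IsLocallyInvariantOrder r)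
    (hH : IsLeftRecurrent r H) : IsLeftOrderable H := by
  refine ⟨fun x y => r 1 (x⁻¹ * y : H), fun x => by simpa using hr.irrefl 1,
    fun x y z h1 h2 => ?_, fun x y hxy => ?_, fun g x y h => by simpa [mul_assoc] using h⟩
  · simpa [mul_assoc] using
      hr.one_mul_mem hH (x⁻¹ * y : H).2 (y⁻¹ * z : H).2 h1 h2
  · have hne : ((x⁻¹ * y : H) : G) ≠ 1 := fun h =>
      hxy (inv_mul_eq_one.1 (Subtype.ext h))
    rcases hr.locallyInvariant 1 _ hne with h | h
    · exact Or.inl (by simpa using h)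
    · exact Or.inr (by simpa using h)

end LocallyInvariant

/-- Left-orderability is a local property: an ultraproduct of left orders on the finitely generated
subgroups is a left order on the whole group. -/
theorem isLeftOrderable_of_forall_fg {G : Type u} [Group G]
    (h : ∀ H : Subgroup G, H.FG → IsLeftOrderable H) : IsLeftOrderable G := by
  classical
  choose r hr using fun F : Finset G => h (Subgroup.closure F) ⟨F, rfl⟩
  let U : Ultrafilter (Finset G) := Ultrafilter.of Filter.atTop
  have hmem : ∀ x : G, ∀ᶠ F : Finset G in U, x ∈ Subgroup.closure (F : Set G) := fun x =>
    Ultrafilter.of_le _ <| (Filter.eventually_ge_atTop {x}).mono fun F hF =>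
      Subgroup.subset_closure (Finset.singleton_subset_iff.1 hF)
  refine ⟨fun x y => ∀ᶠ F : Finset G in U, ∃ hx hy, r F ⟨x, hx⟩ ⟨y, hy⟩, ?_, ?_, ?_, ?_⟩
  · intro x hx
    obtain ⟨F, _, _, hF⟩ := hx.exists
    exact (hr F).irrefl _ hF
  · intro x y z hxy hyz
    filter_upwards [hxy, hyz]
    rintro F ⟨hx, _, h1⟩ ⟨_, hz, h2⟩
    exact ⟨hx, hz, (hr F).trans _ _ _ h1 h2⟩
  · intro x y hxy
    rw [← Ultrafilter.eventually_or]
    filter_upwards [hmem x, hmem y] with F hx hy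
    rcases (hr F).total ⟨x, hx⟩ ⟨y, hy⟩ (fun h => hxy (congrArg Subtype.val h)) with h | h
    · exact Or.inl ⟨hx, hy, h⟩
    · exact Or.inr ⟨hy, hx, h⟩
  · intro g x y hxy
    filter_upwards [hxy, hmem g]
    rintro F ⟨hx, hy, h⟩ hg
    exact ⟨mul_mem hg hx, mul_mem hg hy, (hr F).leftInvariant ⟨g, hg⟩ _ _ h⟩

/-! ### The spaces of locally invariant and of left-invariant orders -/

theorem isClopen_setOf_apply_eq_true {G : Type*} (x y : G) :
    IsClopen {r : G → G → Bool | r x y = true} :=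
  (isClopen_discrete {true}).preimage ((continuous_apply y).comp (continuous_apply x))

theorem isClosed_forall {X : Type*} {ι : Sort*} [TopologicalSpace X] {p : ι → X → Prop}
    (h : ∀ i, IsClosed {x | p i x}) : IsClosed {x | ∀ i, p i x} := by
  rw [Set.ofPred_forall]
  exact isClosed_iInter h

theorem isClosed_setOf_isLocallyInvariantOrder (G : Type u) [Group G] :
    IsClosed {r : G → G → Bool | IsLocallyInvariantOrder fun x y => r x y = true} := by
  have hc := fun x y : G => isClopen_setOf_apply_eq_true x y
  have : {r : G → G → Bool | IsLocallyInvariantOrder fun x y => r x y = true} =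
      {r | (∀ x, ¬ r x x = true) ∧ (∀ x y z, r x y = true → r y z = true → r x z = true) ∧
        ∀ x y, y ≠ 1 → r x (x * y) = true ∨ r x (x * y⁻¹) = true} :=
    Set.ext fun r => ⟨fun h => ⟨h.1, h.2, h.3⟩, fun h => ⟨h.1, h.2.1, h.2.2⟩⟩
  rw [this]
  refine .and (isClosed_forall fun x => (hc x x).compl.1) (.and ?_ ?_)
  · exact isClosed_forall fun x => isClosed_forall fun y =>
      isClosed_forall fun z => isClosed_imp (hc x y).2 (isClosed_imp (hc y z).2 (hc x z).1)
  · exact isClosed_forall fun x => isClosed_forall fun y =>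
      isClosed_forall fun _ => (hc _ _).1.union (hc _ _).1

theorem isClosed_setOf_isLeftInvariantTotalOrder (G : Type u) [Group G] :
    IsClosed {r : G → G → Bool | IsLeftInvariantTotalOrder fun x y => r x y = true} := by
  have hc := fun x y : G => isClopen_setOf_apply_eq_true x y
  have : {r : G → G → Bool | IsLeftInvariantTotalOrder fun x y => r x y = true} =
      {r | (∀ x, ¬ r x x = true) ∧ (∀ x y z, r x y = true → r y z = true → r x z = true) ∧
        (∀ x y, x ≠ y → r x y = true ∨ r y x = true) ∧
        ∀ g x y, r x y = true → r (g * x) (g * y) = true} :=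
    Set.ext fun r => ⟨fun h => ⟨h.1, h.2, h.3, h.4⟩, fun h => ⟨h.1, h.2.1, h.2.2.1, h.2.2.2⟩⟩
  rw [this]
  refine .and (isClosed_forall fun x => (hc x x).compl.1) (.and ?_ (.and ?_ ?_))
  · exact isClosed_forall fun x => isClosed_forall fun y =>
      isClosed_forall fun z => isClosed_imp (hc x y).2 (isClosed_imp (hc y z).2 (hc x z).1)
  · exact isClosed_forall fun x => isClosed_forall fun y =>
      isClosed_forall fun _ => (hc _ _).1.union (hc _ _).1
  · exact isClosed_forall fun g => isClosed_forall fun x =>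
      isClosed_forall fun y => isClosed_imp (hc x y).2 (hc _ _).1

/-! ### Amenable groups -/

theorem IsAmenableGroup.isLeftOrderable_subgroup {G : Type u} [Group G] (hG : IsAmenableGroup G)
    {r₀ : G → G → Prop} (hr₀ : IsLocallyInvariantOrder r₀) (H : Subgroup G) [Countable H] :
    IsLeftOrderable H := by
  classical
  obtain ⟨r, hr, hrec⟩ := hG.exists_recurrent_relation (MulAction.toPermHom G G)
    (isClosed_setOf_isLocallyInvariantOrder G) ⟨fun x y => decide (r₀ x y), by simpa using hr₀⟩
    (fun r (hr : IsLocallyInvariantOrder _) g =>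
      ⟨fun x => hr.irrefl _, fun x y z => hr.trans _ _ _, fun x y hy => by
        simpa [mul_assoc] using hr.locallyInvariant (g * x) y hy⟩) H
  exact IsLocallyInvariantOrder.isLeftOrderable hr hrec

/-- A left-orderable amenable group is locally indicable. -/
theorem IsAmenableGroup.isLocallyIndicable {G : Type u} [Group G] (hG : IsAmenableGroup G)
    (hlo : IsLeftOrderable G) : IsLocallyIndicable G := by
  classical
  intro H hH hbot
  have : Group.FG H := (Group.fg_iff_subgroup_fg H).2 hH
  have : Countable H := countable_of_group_fg H
  have : Nontrivial H := (Subgroup.nontrivial_iff_ne_bot H).2 hbot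
  obtain ⟨r₀, hr₀⟩ := hlo
  obtain ⟨r, hr, hrec⟩ := hG.exists_recurrent_relation (rightTranslation G)
    (isClosed_setOf_isLeftInvariantTotalOrder G) ⟨fun x y => decide (r₀ x y), by simpa using hr₀⟩
    (fun r (hr : IsLeftInvariantTotalOrder _) g =>
      ⟨fun x => hr.irrefl _, fun x y z => hr.trans _ _ _,
        fun x y hxy => hr.total _ _ fun h => hxy ((rightTranslation G g).injective h),
        fun k x y h => by
          simpa [rightTranslation, mul_assoc] using hr.leftInvariant k _ _ h⟩) H
  replace hr : IsLeftInvariantTotalOrder fun x y => r x y = true := hr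
  let _ : LinearOrder H :=
    { le := fun x y => x = y ∨ r x y = true
      le_refl := fun x => Or.inl rfl
      le_trans := by
        rintro x y z (rfl | h1) (rfl | h2)
        · exact Or.inl rfl
        · exact Or.inr h2
        · exact Or.inr h1
        · exact Or.inr (hr.trans _ _ _ h1 h2)
      le_antisymm := by
        rintro x y (rfl | h1) (h2 | h2)
        · rfl
        · rfl
        · exact h2.symm
        · exact absurd (hr.trans _ _ _ h1 h2) (hr.irrefl _)
      le_total := by
        intro x y
        by_cases h : x = y
        · exact Or.inl (Or.inl h)
        · exact (hr.total x y fun h' => h (Subtype.ext h')).imp Or.inr Or.inr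
      toDecidableLE := Classical.decRel _ }
  have lt_iff : ∀ x y : H, x < y ↔ r x y = true := fun x y =>
    ⟨fun h => h.le.resolve_left h.ne, fun h => lt_of_le_of_ne (Or.inr h) fun hxy =>
      hr.irrefl x (by rwa [← hxy] at h)⟩
  have : MulLeftMono H := ⟨fun g x y h => by
    rcases h with rfl | h
    · exact le_rfl
    · exact Or.inr (hr.leftInvariant g _ _ h)⟩
  -- Recurrence of `1 < f` under right translation by powers of `g` gives `g ^ n < f * g ^ n`.
  have hC : IsConradian H := by
    intro f g hf hg
    obtain ⟨n, hn, h⟩ := hrec _ (inv_mem g.2) 1 (one_mem H) f f.2 ((lt_iff 1 f).1 hf)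
    have h' : g ^ n < f * g ^ n := (lt_iff _ _).2 (by simpa [rightTranslation] using h)
    have hn' : g ≤ g ^ n := by
      simpa using (zpow_strictMono_of_one_lt hg).monotone (by exact_mod_cast hn : (1 : ℤ) ≤ n)
    exact ⟨n, hn'.trans_lt h'⟩
  obtain ⟨φ, hφ⟩ := hC.exists_surjective_hom_int
  let e := QuotientGroup.quotientKerEquivOfSurjective φ hφ
  exact ⟨φ.ker, inferInstance, e.symm.isCyclic.1 inferInstance,
    Infinite.of_injective _ e.symm.injective⟩

theorem theorem1p1 (G : Type u) [Group G] (hamen : IsAmenableGroup G)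
    (hlio : ∃ r : G → G → Prop, IsLocallyInvariantOrder r) :
    IsLeftOrderable G ∧ IsLocallyIndicable G := by
  obtain ⟨r, hr⟩ := hlio
  have hlo : IsLeftOrderable G := isLeftOrderable_of_forall_fg fun H hH => by
    have : Group.FG H := (Group.fg_iff_subgroup_fg H).2 hH
    have : Countable H := countable_of_group_fg H
    exact hamen.isLeftOrderable_subgroup hr H
  exact ⟨hlo, hamen.isLocallyIndicable hlo⟩
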